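/- Let $[n]=\{1,\dots,n\}$ and let $\log$ denote the base-2 logarithm. Sets $S_1,\dots,S_k\subseteq[n]$ form a *$k$-moonflower* if there is a set $I\subseteq[n]$ such that $S_1\setminus I,\dots,S_k\setminus I$ are all nonempty and pairwise disjoint; a family $\mathcal F\subseteq 2^{[n]}$ is *$k$-moonflower-free* if no $k$ members of it form a $k$-moonflower. A probability distribution $D$ on $2^{[n]}$ supported on $\mathcal F$ is *$p$-smooth* if $\Pr_{S\sim D}[i\in S]\le p$ for every $i\in[n]$. Write $\phi(p)=p\log(1/p)$, and let $H(D)=\sum_S D(S)\log(1/D(S))$ be the Shannon entropy (in bits, with $0\log(1/0)=0$). There is an absolute constant $B\ge 1$ such that the following holds. Let $\mathcal F\subseteq 2^{[n]}$ be $k$-moonflower-free, let $0<p\le 1/2$, and let $D$ be a $p$-smooth distribution supported on $\mathcal F$. If $n\ge 2k$, then $$H(D)\le B\cdot k\log(n/k)\cdot\phi(p).$$ More generally, if $n\ge k$, then $$H(D)\le B\cdot k\log(en/k)\cdot\phi(p).$$ -/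

import Mathlib

/-- The sets `S 0, …, S (k-1)` form a `k`-moonflower: for some set `I`, the sets `S i \ I` are
nonempty and pairwise disjoint. -/
def IsMoonflower {n k : ℕ} (S : Fin k → Finset (Fin n)) : Prop :=
  ∃ I : Finset (Fin n), (∀ i, (S i \ I).Nonempty) ∧
    ∀ i j, i ≠ j → Disjoint (S i \ I) (S j \ I)

/-- The family `F` contains no `k`-moonflower. -/
def MoonflowerFree {n : ℕ} (k : ℕ) (F : Finset (Finset (Fin n))) : Prop :=
  ¬ ∃ S : Fin k → Finset (Fin n), (∀ i, S i ∈ F) ∧ IsMoonflower S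

/-- The distribution `D` on subsets of `[n]` gives probability one to `F`. -/
def SupportedOn {n : ℕ} (D : PMF (Finset (Fin n))) (F : Finset (Finset (Fin n))) : Prop :=
  ∀ S, D S ≠ 0 → S ∈ F

/-- `Pr_{S ∼ D}[i ∈ S] ≤ p` for every coordinate `i`. -/
def IsSmooth {n : ℕ} (p : ℝ) (D : PMF (Finset (Fin n))) : Prop :=
  ∀ i : Fin n, ∑ S with i ∈ S, (D S).toReal ≤ p

/-- Shannon entropy in bits, `∑ D(S) log₂ (1 / D(S))`; terms with `D(S) = 0` vanish. -/
noncomputable def shannonEntropy {n : ℕ} (D : PMF (Finset (Fin n))) : ℝ :=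
  ∑ S, (D S).toReal * Real.logb 2 (1 / (D S).toReal)

/-- `φ(p) = p log₂ (1/p)`. -/
noncomputable def phi (p : ℝ) : ℝ := p * Real.logb 2 (1 / p)

/-!
If `U` is the union of `m ≈ 1 / (2p)` independent samples from `D`, then `H(U)` exceeds `H(D)` by a
factor at least of order `m / log m`. This is shown one coordinate at a time, by the chain rule:
if the events that the samples avoid the coordinate have conditional probabilities `x₁, …, x_m`
given the earlier coordinates, then `U` avoids it with conditional probability `∏ xⱼ`, and
`∑ᵢ (∏_{j ≠ i} xⱼ) h(xᵢ) ≤ 5 (1 + log m) h(∏ xⱼ)` for the binary entropy `h`. Independence turns the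
left side into `m (E x) ^ (m - 1) E h(x)`, where `(E x) ^ (m - 1) ≥ 1 / 2` by smoothness.

On the other hand `U` ranges over the unions of subfamilies of `F`. If these shattered a set of size
`k`, a member of `F` could be found through each of its points avoiding the other `k - 1`, and these
members would form a `k`-moonflower. Hence `H(U) ≤ k log (e n / k)` by the Sauer–Shelah lemma.
-/

open Finset Real

section BinaryEntropy

theorem negMulLog_le_tangent {x t : ℝ} (hx : 0 ≤ x) (ht : 0 < t) :
    negMulLog x ≤ x * -log t + (t - x) := by
  calc negMulLog x = negMulLog (t * (x / t)) := by rw [mul_div_cancel₀ _ ht.ne']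
    _ = x * -log t + t * negMulLog (x / t) := by
      rw [negMulLog_mul, negMulLog]
      field_simp
    _ ≤ x * -log t + t * (1 - x / t) := by
      gcongr
      exact negMulLog_le_one_sub_self (by positivity)
    _ = x * -log t + (t - x) := by field_simp

theorem one_sub_le_neg_log {x : ℝ} (hx : 0 < x) : 1 - x ≤ -log x := by
  linarith [log_le_sub_one_of_pos hx]

theorem mul_one_sub_le_negMulLog {x : ℝ} (hx : 0 ≤ x) : x * (1 - x) ≤ negMulLog x := by
  rcases hx.eq_or_lt with rfl | hx
  · simp
  · rw [negMulLog, neg_mul, ← mul_neg]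
    exact mul_le_mul_of_nonneg_left (one_sub_le_neg_log hx) hx.le

theorem negMulLog_one_sub_le {x t : ℝ} (hx0 : 0 ≤ x) (hx1 : x ≤ 1) (ht0 : 0 < t) (ht1 : t ≤ 1) :
    negMulLog (1 - x) ≤ 2 * ((1 - log t) * negMulLog x + t * x) := by
  have hlog : 0 ≤ -log t := neg_nonneg.2 (log_nonpos ht0.le ht1)
  have hneg : x * (1 - x) ≤ negMulLog x := mul_one_sub_le_negMulLog hx0
  have hprod : 0 ≤ -log t * negMulLog x := mul_nonneg hlog (negMulLog_nonneg hx0 hx1)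
  rcases le_total x (1 / 2) with hx | hx
  · have hsub : negMulLog (1 - x) ≤ x := by
      simpa using negMulLog_le_one_sub_self (x := 1 - x) (by linarith)
    nlinarith [mul_nonneg ht0.le hx0]
  · have htan := negMulLog_le_tangent (x := 1 - x) (by linarith) ht0
    have hscale : (1 - x) * -log t ≤ 2 * (-log t * negMulLog x) := by
      calc (1 - x) * -log t = -log t * (1 * (1 - x)) := by ring
        _ ≤ -log t * (2 * x * (1 - x)) := by gcongr; linarith
        _ = -log t * (2 * (x * (1 - x))) := by ring
        _ ≤ -log t * (2 * negMulLog x) := by gcongr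
        _ = 2 * (-log t * negMulLog x) := by ring
    nlinarith

theorem negMulLog_prod {ι : Type*} [DecidableEq ι] (s : Finset ι) (x : ι → ℝ) :
    negMulLog (∏ i ∈ s, x i) = ∑ i ∈ s, (∏ j ∈ s.erase i, x j) * negMulLog (x i) := by
  induction s using Finset.induction_on with
  | empty => simp
  | insert a s ha ih =>
    have herase : ∀ i ∈ s, ∏ j ∈ (insert a s).erase i, x j = x a * ∏ j ∈ s.erase i, x j :=
      fun i hi => by
        rw [erase_insert_of_ne (ne_of_mem_of_not_mem hi ha).symm,
          prod_insert (fun h => ha (mem_of_mem_erase h))]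
    rw [prod_insert ha, negMulLog_mul, ih, sum_insert ha, erase_insert ha, mul_sum]
    congr 1
    exact sum_congr rfl fun i hi => by rw [herase i hi, mul_assoc]

theorem sum_prod_erase_mul_binEntropy_le_of_pos {ι : Type*} [DecidableEq ι] (s : Finset ι)
    {x : ι → ℝ} (hx0 : ∀ i ∈ s, 0 ≤ x i) (hx1 : ∀ i ∈ s, x i ≤ 1) {t : ℝ} (ht0 : 0 < t)
    (ht1 : t ≤ 1) :
    ∑ i ∈ s, (∏ j ∈ s.erase i, x j) * binEntropy (x i) ≤
      (3 - 2 * log t) * negMulLog (∏ i ∈ s, x i) + 2 * (#s * t) * ∏ i ∈ s, x i := by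
  calc ∑ i ∈ s, (∏ j ∈ s.erase i, x j) * binEntropy (x i)
      ≤ ∑ i ∈ s, (∏ j ∈ s.erase i, x j) *
          (negMulLog (x i) + 2 * ((1 - log t) * negMulLog (x i) + t * x i)) := by
        refine sum_le_sum fun i hi => mul_le_mul_of_nonneg_left ?_
          (prod_nonneg fun j hj => hx0 j (mem_of_mem_erase hj))
        rw [binEntropy_eq_negMulLog_add_negMulLog_one_sub]
        gcongr
        exact negMulLog_one_sub_le (hx0 i hi) (hx1 i hi) ht0 ht1
    _ = ∑ i ∈ s, ((3 - 2 * log t) * ((∏ j ∈ s.erase i, x j) * negMulLog (x i)) +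
          2 * t * ∏ i ∈ s, x i) := by
        refine sum_congr rfl fun i hi => ?_
        rw [← prod_erase_mul s x hi]
        ring
    _ = (3 - 2 * log t) * negMulLog (∏ i ∈ s, x i) + 2 * (#s * t) * ∏ i ∈ s, x i := by
        rw [sum_add_distrib, ← mul_sum, ← negMulLog_prod, sum_const, nsmul_eq_mul]
        ring

theorem sum_prod_erase_mul_binEntropy_le {ι : Type*} [DecidableEq ι] (s : Finset ι) {x : ι → ℝ}
    (hx0 : ∀ i ∈ s, 0 ≤ x i) (hx1 : ∀ i ∈ s, x i ≤ 1) :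
    ∑ i ∈ s, (∏ j ∈ s.erase i, x j) * binEntropy (x i) ≤
      5 * (1 + log #s) * binEntropy (∏ i ∈ s, x i) := by
  set r := ∏ i ∈ s, x i with hr
  have hr0 : 0 ≤ r := prod_nonneg hx0
  rcases (prod_le_one hx0 hx1).eq_or_lt with hr1 | hr1
  · have hx : ∀ i ∈ s, x i = 1 := fun i hi => (hx1 i hi).antisymm <| by
      rw [← hr1, ← mul_prod_erase s x hi]
      exact mul_le_of_le_one_right (hx0 i hi)
        (prod_le_one (fun j hj => hx0 j (mem_of_mem_erase hj))
          fun j hj => hx1 j (mem_of_mem_erase hj))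
    rw [← hr] at hr1
    rw [sum_eq_zero fun i hi => by rw [hx i hi, binEntropy_one, mul_zero], hr1, binEntropy_one,
      mul_zero]
  · have hs : s.Nonempty := nonempty_of_prod_ne_one hr1.ne
    have hcard : (1 : ℝ) ≤ #s := by exact_mod_cast hs.card_pos
    have hgap : 0 < 1 - r := sub_pos.2 hr1
    have hlog : -log (1 - r) * negMulLog r ≤ negMulLog (1 - r) := by
      calc -log (1 - r) * negMulLog r ≤ -log (1 - r) * (1 - r) :=
            mul_le_mul_of_nonneg_left (negMulLog_le_one_sub_self hr0)
              (neg_nonneg.2 (log_nonpos hgap.le (sub_le_self 1 hr0)))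
        _ = negMulLog (1 - r) := by rw [negMulLog, neg_mul_comm, mul_comm]
    have hmain := sum_prod_erase_mul_binEntropy_le_of_pos s hx0 hx1 (t := (1 - r) / #s)
      (by positivity) ((div_le_one (by positivity)).2 (by linarith))
    rw [← hr, mul_div_cancel₀ _ (by positivity), log_div hgap.ne' (by positivity)] at hmain
    rw [binEntropy_eq_negMulLog_add_negMulLog_one_sub]
    have hlogcard : 0 ≤ log #s := log_natCast_nonneg _
    have hneg : 0 ≤ negMulLog r := negMulLog_nonneg hr0 hr1.le
    have hneg' : 0 ≤ negMulLog (1 - r) := negMulLog_nonneg hgap.le (sub_le_self 1 hr0)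
    linarith [mul_one_sub_le_negMulLog hr0, mul_nonneg hlogcard hneg, mul_nonneg hlogcard hneg']

theorem sum_prod_mul_prod_erase_mul {ι β R : Type*} [Fintype ι] [DecidableEq ι] [Fintype β]
    [CommSemiring R] (a f g : β → R) (i : ι) :
    ∑ c : ι → β, (∏ j, a (c j)) * ((∏ j ∈ univ.erase i, f (c j)) * g (c i)) =
      (∑ b, a b * f b) ^ (Fintype.card ι - 1) * ∑ b, a b * g b := by
  have hsplit : ∀ c : ι → β, (∏ j, a (c j)) * ((∏ j ∈ univ.erase i, f (c j)) * g (c i)) =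
      ∏ j, if j = i then a (c j) * g (c j) else a (c j) * f (c j) := fun c => by
    rw [← prod_erase_mul univ _ (mem_univ i), ← prod_erase_mul univ _ (mem_univ i), if_pos rfl,
      prod_congr rfl fun j hj => if_neg (ne_of_mem_erase hj), prod_mul_distrib]
    ring
  have hsum : ∏ j, ∑ b, (if j = i then a b * g b else a b * f b) =
      (∑ b, a b * f b) ^ (Fintype.card ι - 1) * ∑ b, a b * g b := by
    rw [← prod_erase_mul univ _ (mem_univ i)]
    simp only [if_true]
    rw [prod_congr rfl fun j hj => sum_congr rfl fun b _ => if_neg (ne_of_mem_erase hj),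
      prod_const, card_erase_of_mem (mem_univ i), card_univ]
  rw [← hsum, Fintype.prod_sum]
  exact sum_congr rfl fun c _ => hsplit c

theorem card_mul_pow_mul_sum_mul_binEntropy_le (ι : Type*) [Fintype ι] [DecidableEq ι] {β : Type*}
    [Fintype β] {a x : β → ℝ} (ha : ∀ b, 0 ≤ a b) (hx0 : ∀ b, 0 ≤ x b) (hx1 : ∀ b, x b ≤ 1) :
    Fintype.card ι * (∑ b, a b * x b) ^ (Fintype.card ι - 1) * ∑ b, a b * binEntropy (x b) ≤
      5 * (1 + log (Fintype.card ι)) *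
        ∑ c : ι → β, (∏ j, a (c j)) * binEntropy (∏ j, x (c j)) := by
  calc _ = ∑ i : ι, ∑ c : ι → β, (∏ j, a (c j)) *
      ((∏ j ∈ univ.erase i, x (c j)) * binEntropy (x (c i))) := by
        simp only [sum_prod_mul_prod_erase_mul a x fun b => binEntropy (x b), sum_const, card_univ,
          nsmul_eq_mul, mul_assoc]
    _ = ∑ c : ι → β, (∏ j, a (c j)) * ∑ i,
      (∏ j ∈ univ.erase i, x (c j)) * binEntropy (x (c i)) := by
        rw [sum_comm]
        simp only [mul_sum]
    _ ≤ ∑ c : ι → β, (∏ j, a (c j)) *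
          (5 * (1 + log (Fintype.card ι)) * binEntropy (∏ j, x (c j))) := by
        gcongr with c
        · exact prod_nonneg fun j _ => ha _
        · exact sum_prod_erase_mul_binEntropy_le univ (fun j _ => hx0 (c j)) fun j _ => hx1 (c j)
    _ = _ := by
        rw [mul_sum]
        exact sum_congr rfl fun c _ => mul_left_comm _ _ _

end BinaryEntropy

section Entropy

variable {Ω β γ : Type*} [Fintype Ω] [DecidableEq β] [DecidableEq γ]

/-- The distribution of the random variable `X` when the outcome `ω` has weight `w ω`. -/
def law (w : Ω → ℝ) (X : Ω → β) (b : β) : ℝ := ∑ ω with X ω = b, w ω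

/-- The Shannon entropy, in nats, of the random variable `X`. -/
noncomputable def entropy [Fintype β] (w : Ω → ℝ) (X : Ω → β) : ℝ := ∑ b, negMulLog (law w X b)

/-- The conditional probability of the event `E` given `X = b`; it is `0` when `X = b` has
probability zero. -/
noncomputable def condProb (w : Ω → ℝ) (E : Set Ω) (X : Ω → β) (b : β) : ℝ :=
  law (E.indicator w) X b / law w X b

/-- The conditional entropy, in nats, of the indicator of the event `E` given `X`. -/
noncomputable def condEntropy [Fintype β] (w : Ω → ℝ) (E : Set Ω) (X : Ω → β) : ℝ :=
  ∑ b, law w X b * binEntropy (condProb w E X b)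

variable {w : Ω → ℝ}

theorem law_nonneg (hw : ∀ ω, 0 ≤ w ω) (X : Ω → β) (b : β) : 0 ≤ law w X b :=
  sum_nonneg fun ω _ => hw ω

theorem sum_law [Fintype β] (w : Ω → ℝ) (X : Ω → β) : ∑ b, law w X b = ∑ ω, w ω :=
  sum_fiberwise univ X w

theorem law_comp [Fintype β] (w : Ω → ℝ) (X : Ω → β) (φ : β → γ) (c : γ) :
    law w (φ ∘ X) c = ∑ b with φ b = c, law w X b := by
  simp only [law, Function.comp_apply]
  rw [← sum_fiberwise_of_maps_to (s := {ω | φ (X ω) = c}) (g := X) (t := {b | φ b = c}) (by simp)]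
  refine sum_congr rfl fun b hb => sum_congr ?_ fun _ _ => rfl
  grind

theorem law_indicator_add_law_compl_indicator (w : Ω → ℝ) (E : Set Ω) (X : Ω → β) (b : β) :
    law (E.indicator w) X b + law (Eᶜ.indicator w) X b = law w X b := by
  simp only [law, ← sum_add_distrib, Set.indicator_self_add_compl_apply]

theorem law_indicator_nonneg (hw : ∀ ω, 0 ≤ w ω) (E : Set Ω) (X : Ω → β) (b : β) :
    0 ≤ law (E.indicator w) X b :=
  law_nonneg (Set.indicator_nonneg fun ω _ => hw ω) X b

theorem law_indicator_le_law (hw : ∀ ω, 0 ≤ w ω) (E : Set Ω) (X : Ω → β) (b : β) :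
    law (E.indicator w) X b ≤ law w X b :=
  sum_le_sum fun ω _ => Set.indicator_le_self' (fun ω _ => hw ω) ω

theorem condProb_nonneg (hw : ∀ ω, 0 ≤ w ω) (E : Set Ω) (X : Ω → β) (b : β) :
    0 ≤ condProb w E X b :=
  div_nonneg (law_indicator_nonneg hw E X b) (law_nonneg hw X b)

theorem condProb_le_one (hw : ∀ ω, 0 ≤ w ω) (E : Set Ω) (X : Ω → β) (b : β) :
    condProb w E X b ≤ 1 :=
  div_le_one_of_le₀ (law_indicator_le_law hw E X b) (law_nonneg hw X b)

theorem law_mul_condProb (hw : ∀ ω, 0 ≤ w ω) (E : Set Ω) (X : Ω → β) (b : β) :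
    law w X b * condProb w E X b = law (E.indicator w) X b :=
  mul_div_cancel_of_imp' fun h =>
    ((law_indicator_le_law hw E X b).trans_eq h).antisymm (law_indicator_nonneg hw E X b)

theorem law_mul_one_sub_condProb (hw : ∀ ω, 0 ≤ w ω) (E : Set Ω) (X : Ω → β) (b : β) :
    law w X b * (1 - condProb w E X b) = law (Eᶜ.indicator w) X b := by
  rw [mul_one_sub, law_mul_condProb hw, ← law_indicator_add_law_compl_indicator w E,
    add_sub_cancel_left]

theorem condEntropy_nonneg [Fintype β] (hw : ∀ ω, 0 ≤ w ω) (E : Set Ω) (X : Ω → β) :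
    0 ≤ condEntropy w E X :=
  sum_nonneg fun b _ => mul_nonneg (law_nonneg hw X b)
    (binEntropy_nonneg (condProb_nonneg hw E X b) (condProb_le_one hw E X b))

theorem entropy_const [Fintype β] (hw : ∑ ω, w ω = 1) (b : β) : entropy w (fun _ => b) = 0 :=
  sum_eq_zero fun c _ => by by_cases h : b = c <;> simp [law, h, hw]

theorem entropy_eq_sum_mul_neg_log [Fintype β] (w : Ω → ℝ) (X : Ω → β) :
    entropy w X = ∑ ω, w ω * -log (law w X (X ω)) := by
  rw [entropy, ← sum_fiberwise univ X]
  refine sum_congr rfl fun b _ => ?_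
  rw [negMulLog, neg_mul_comm, law, sum_mul]
  refine sum_congr rfl fun ω hω => ?_
  rw [(mem_filter.1 hω).2, law]

theorem entropy_congr [Fintype β] [Fintype γ] (w : Ω → ℝ) {X : Ω → β} {Y : Ω → γ}
    (h : ∀ ω ω', X ω = X ω' ↔ Y ω = Y ω') : entropy w X = entropy w Y := by
  simp only [entropy_eq_sum_mul_neg_log, law, h]

open Classical in
theorem entropy_prodMk_decide [Fintype β] (hw : ∀ ω, 0 ≤ w ω) (E : Set Ω) (X : Ω → β) :
    entropy w (fun ω => (X ω, decide (ω ∈ E))) = entropy w X + condEntropy w E X := by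
  have htrue : ∀ b, law w (fun ω => (X ω, decide (ω ∈ E))) (b, true) =
      law w X b * condProb w E X b := fun b => by
    rw [law_mul_condProb hw]
    simp [law, Set.indicator_apply, sum_filter, ite_and]
  have hfalse : ∀ b, law w (fun ω => (X ω, decide (ω ∈ E))) (b, false) =
      law w X b * (1 - condProb w E X b) := fun b => by
    rw [law_mul_one_sub_condProb hw]
    simp [law, Set.indicator_apply, sum_filter, ite_and]
  simp only [entropy, condEntropy]
  rw [Fintype.sum_prod_type, ← sum_add_distrib]
  refine sum_congr rfl fun b _ => ?_
  rw [Fintype.sum_bool, htrue, hfalse, negMulLog_mul, negMulLog_mul,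
    binEntropy_eq_negMulLog_add_negMulLog_one_sub]
  ring

theorem entropy_eq_entropy_add_condEntropy [Fintype β] [Fintype γ] (hw : ∀ ω, 0 ≤ w ω)
    {E : Set Ω} {X : Ω → β} {Y : Ω → γ}
    (h : ∀ ω ω', Y ω = Y ω' ↔ X ω = X ω' ∧ (ω ∈ E ↔ ω' ∈ E)) :
    entropy w Y = entropy w X + condEntropy w E X := by
  classical
  rw [← entropy_prodMk_decide hw]
  exact entropy_congr w fun ω ω' => by simp [h]

theorem condEntropy_le_condEntropy_comp [Fintype β] [Fintype γ] (hw : ∀ ω, 0 ≤ w ω) (E : Set Ω)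
    (X : Ω → β) (φ : β → γ) : condEntropy w E X ≤ condEntropy w E (φ ∘ X) := by
  rw [condEntropy, condEntropy, ← sum_fiberwise univ φ]
  refine sum_le_sum fun c _ => ?_
  rcases (law_nonneg hw (φ ∘ X) c).eq_or_lt with hc | hc
  · have hfibre : ∀ b ∈ ({b | φ b = c} : Finset β), law w X b = 0 := by
      rw [← sum_eq_zero_iff_of_nonneg fun b _ => law_nonneg hw X b, ← law_comp, ← hc]
    rw [← hc, zero_mul, sum_eq_zero fun b hb => by rw [hfibre b hb, zero_mul]]
  · rw [law_comp] at hc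
    have hjensen := strictConcave_binEntropy.concaveOn.le_map_centerMass
      (fun b _ => law_nonneg hw X b) hc
      (fun b _ => ⟨condProb_nonneg hw E X b, condProb_le_one hw E X b⟩)
    simp only [centerMass, smul_eq_mul, law_mul_condProb hw, ← law_comp] at hjensen hc
    rwa [inv_mul_le_iff₀ hc, inv_mul_eq_div] at hjensen

theorem entropy_le_log_card [Fintype β] (hw : ∀ ω, 0 ≤ w ω) (hw1 : ∑ ω, w ω = 1) {X : Ω → β}
    {s : Finset β} (hs : ∀ ω, w ω ≠ 0 → X ω ∈ s) : entropy w X ≤ log #s := by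
  have hzero : ∀ b ∉ s, law w X b = 0 := fun b hb => sum_eq_zero fun ω hω => by
    by_contra hne
    exact hb ((mem_filter.1 hω).2 ▸ hs ω hne)
  have hsum : ∑ b ∈ s, law w X b = 1 := by
    rw [sum_subset (subset_univ s) fun b _ => hzero b, sum_law, hw1]
  have hcard : (0 : ℝ) < #s := by
    exact_mod_cast (nonempty_of_sum_ne_zero (hsum.trans_ne one_ne_zero)).card_pos
  calc entropy w X = ∑ b ∈ s, negMulLog (law w X b) :=
        (sum_subset (subset_univ s) fun b _ hb => by rw [hzero b hb, negMulLog_zero]).symm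
    _ ≤ ∑ b ∈ s, (law w X b * -log (#s : ℝ)⁻¹ + ((#s : ℝ)⁻¹ - law w X b)) :=
        sum_le_sum fun b _ => negMulLog_le_tangent (law_nonneg hw X b) (inv_pos.2 hcard)
    _ = log #s := by
        rw [sum_add_distrib, ← sum_mul, sum_sub_distrib, hsum, sum_const, nsmul_eq_mul,
          mul_inv_cancel₀ hcard.ne', log_inv]
        ring

end Entropy

section IndependentCopies

variable {ι Ω β : Type*} [Fintype ι]

/-- The weight of a family of independent outcomes, each of them weighted by `w`. -/
def piWeight (ι : Type*) [Fintype ι] (w : Ω → ℝ) (ω : ι → Ω) : ℝ := ∏ j, w (ω j)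

theorem piWeight_nonneg {w : Ω → ℝ} (hw : ∀ ω, 0 ≤ w ω) (ω : ι → Ω) : 0 ≤ piWeight ι w ω :=
  prod_nonneg fun j _ => hw (ω j)

theorem piWeight_indicator (w : Ω → ℝ) (E : Set Ω) :
    piWeight ι (E.indicator w) = {ω : ι → Ω | ∀ j, ω j ∈ E}.indicator (piWeight ι w) := by
  classical
  ext ω
  simp only [piWeight, Set.indicator_apply, prod_ite_zero, mem_univ, true_imp_iff,
    Set.mem_ofPred_eq]

variable [DecidableEq ι] [Fintype Ω] [DecidableEq β]

theorem sum_piWeight (w : Ω → ℝ) :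
    ∑ ω, piWeight ι w ω = (∑ ω, w ω) ^ Fintype.card ι := by
  simp only [piWeight, ← Fintype.prod_sum, prod_const, card_univ]

theorem law_piWeight (w : Ω → ℝ) (X : Ω → β) (c : ι → β) :
    law (piWeight ι w) (fun ω j => X (ω j)) c = ∏ j, law w X (c j) := by
  simp only [law, piWeight, prod_univ_sum]
  refine sum_congr ?_ fun _ _ => rfl
  ext ω
  simp [funext_iff]

theorem condProb_piWeight (w : Ω → ℝ) (E : Set Ω) (X : Ω → β) (c : ι → β) :
    condProb (piWeight ι w) {ω | ∀ j, ω j ∈ E} (fun ω j => X (ω j)) c =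
      ∏ j, condProb w E X (c j) := by
  simp only [condProb, ← piWeight_indicator, law_piWeight, prod_div_distrib]

theorem card_mul_pow_mul_condEntropy_le [Fintype β] {w : Ω → ℝ} (hw : ∀ ω, 0 ≤ w ω) (E : Set Ω)
    (X : Ω → β) :
    Fintype.card ι * (∑ ω, E.indicator w ω) ^ (Fintype.card ι - 1) * condEntropy w E X ≤
      5 * (1 + log (Fintype.card ι)) *
        condEntropy (piWeight ι w) {ω | ∀ j, ω j ∈ E} (fun ω j => X (ω j)) := by
  have h := card_mul_pow_mul_sum_mul_binEntropy_le ι (law_nonneg hw X) (condProb_nonneg hw E X)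
    (condProb_le_one hw E X)
  simp only [law_mul_condProb hw, sum_law] at h
  simpa only [condEntropy, law_piWeight, condProb_piWeight] using h

end IndependentCopies

section Unions

variable {α ι : Type*} [DecidableEq α]

theorem inter_insert_eq_inter_insert_iff {S T A : Finset α} {a : α} :
    S ∩ insert a A = T ∩ insert a A ↔ S ∩ A = T ∩ A ∧ (a ∉ S ↔ a ∉ T) := by
  simp only [Finset.ext_iff, mem_inter, mem_insert]
  grind

theorem card_mul_pow_mul_condEntropy_inter_le [Fintype α] [Fintype ι] [DecidableEq ι]
    {w : Finset α → ℝ} (hw : ∀ S, 0 ≤ w S) (a : α) (A : Finset α) :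
    Fintype.card ι * (∑ S, {S | a ∉ S}.indicator w S) ^ (Fintype.card ι - 1) *
        condEntropy w {S | a ∉ S} (· ∩ A) ≤
      5 * (1 + log (Fintype.card ι)) *
        condEntropy (piWeight ι w) {ω | ∀ j, a ∉ ω j} (fun ω => univ.biUnion ω ∩ A) := by
  have hforget : condEntropy (piWeight ι w) {ω | ∀ j, a ∉ ω j} (fun ω j => ω j ∩ A) ≤
      condEntropy (piWeight ι w) {ω | ∀ j, a ∉ ω j} (fun ω => univ.biUnion ω ∩ A) := by
    simp only [biUnion_inter]
    exact condEntropy_le_condEntropy_comp (piWeight_nonneg hw) _ _ univ.biUnion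
  calc _ ≤ 5 * (1 + log (Fintype.card ι)) *
        condEntropy (piWeight ι w) {ω | ∀ j, a ∉ ω j} (fun ω j => ω j ∩ A) :=
        card_mul_pow_mul_condEntropy_le hw {S | a ∉ S} (· ∩ A)
    _ ≤ _ := by gcongr

theorem mul_entropy_inter_le_entropy_biUnion_inter [Fintype α] [Fintype ι] [DecidableEq ι]
    {w : Finset α → ℝ} (hw : ∀ S, 0 ≤ w S) (hw1 : ∑ S, w S = 1) {c : ℝ}
    (hc : ∀ a, c ≤ (∑ S, {S | a ∉ S}.indicator w S) ^ (Fintype.card ι - 1)) (A : Finset α) :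
    Fintype.card ι * c * entropy w (· ∩ A) ≤ 5 * (1 + log (Fintype.card ι)) *
      entropy (piWeight ι w) (fun ω => univ.biUnion ω ∩ A) := by
  induction A using Finset.induction_on with
  | empty =>
    have hpi : ∑ ω, piWeight ι w ω = 1 := by rw [sum_piWeight, hw1, one_pow]
    simp only [inter_empty, entropy_const hw1, entropy_const hpi, mul_zero, le_refl]
  | insert a A _ ih =>
    have hsplit : entropy w (· ∩ insert a A) =
        entropy w (· ∩ A) + condEntropy w {S | a ∉ S} (· ∩ A) :=
      entropy_eq_entropy_add_condEntropy hw fun S T => inter_insert_eq_inter_insert_iff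
    have hsplit_union : entropy (piWeight ι w) (fun ω => univ.biUnion ω ∩ insert a A) =
        entropy (piWeight ι w) (fun ω => univ.biUnion ω ∩ A) +
          condEntropy (piWeight ι w) {ω | ∀ j, a ∉ ω j} (fun ω => univ.biUnion ω ∩ A) :=
      entropy_eq_entropy_add_condEntropy (piWeight_nonneg hw) fun ω ω' => by
        simpa using inter_insert_eq_inter_insert_iff (S := univ.biUnion ω) (T := univ.biUnion ω')
    rw [hsplit, hsplit_union, mul_add, mul_add]
    refine add_le_add ih ((mul_le_mul_of_nonneg_right ?_ (condEntropy_nonneg hw _ _)).trans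
      (card_mul_pow_mul_condEntropy_inter_le hw a A))
    gcongr
    exact hc a

theorem mul_entropy_le_entropy_biUnion [Fintype α] [Fintype ι] [DecidableEq ι] {w : Finset α → ℝ}
    (hw : ∀ S, 0 ≤ w S) (hw1 : ∑ S, w S = 1) {c : ℝ}
    (hc : ∀ a, c ≤ (∑ S, {S | a ∉ S}.indicator w S) ^ (Fintype.card ι - 1)) :
    Fintype.card ι * c * entropy w id ≤ 5 * (1 + log (Fintype.card ι)) *
      entropy (piWeight ι w) (univ.biUnion ·) := by
  simpa only [inter_univ, ← Function.id_def] using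
    mul_entropy_inter_le_entropy_biUnion_inter hw hw1 hc univ

/-- The family of all unions of subfamilies of `F`, including the empty union. -/
def unionClosure (F : Finset (Finset α)) : Finset (Finset α) := F.powerset.image (·.biUnion id)

theorem biUnion_mem_unionClosure {F : Finset (Finset α)} (s : Finset ι) {S : ι → Finset α}
    (hS : ∀ j ∈ s, S j ∈ F) : s.biUnion S ∈ unionClosure F :=
  mem_image.2 ⟨s.image S, mem_powerset.2 (image_subset_iff.2 hS), image_biUnion⟩

theorem unionClosure_nonempty (F : Finset (Finset α)) : (unionClosure F).Nonempty :=
  F.powerset_nonempty.image _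

theorem exists_mem_inter_eq_singleton_of_shatters_unionClosure {F : Finset (Finset α)}
    {X : Finset α} (hX : (unionClosure F).Shatters X) {a : α} (ha : a ∈ X) :
    ∃ S ∈ F, X ∩ S = {a} := by
  obtain ⟨U, hU, hXU⟩ := hX.exists_inter_eq_singleton ha
  obtain ⟨G, hG, rfl⟩ := mem_image.1 hU
  obtain ⟨S, hS, haS⟩ := mem_biUnion.1 (mem_of_mem_inter_right (hXU ▸ mem_singleton_self a))
  refine ⟨S, mem_powerset.1 hG hS, Subset.antisymm ?_ ?_⟩
  · rw [← hXU]
    exact inter_subset_inter_left (subset_biUnion_of_mem id hS)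
  · exact singleton_subset_iff.2 (mem_inter.2 ⟨ha, haS⟩)

theorem exists_half_le_one_sub_pow {p : ℝ} (hp0 : 0 < p) (hp : p ≤ 1 / 2) :
    ∃ m : ℕ, 1 ≤ 2 * (m * p) ∧ m * p ≤ 1 ∧ 1 / 2 ≤ (1 - p) ^ (m - 1) := by
  set m := ⌈1 / (2 * p)⌉₊
  have hm_ge : 1 ≤ 2 * (m * p) := by
    have := (div_le_iff₀ (by positivity)).1 (Nat.le_ceil (1 / (2 * p)))
    linarith
  have hm_pred : (m - 1) * p ≤ 1 / 2 := by
    have := Nat.ceil_lt_add_one (show 0 ≤ 1 / (2 * p) by positivity)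
    calc (m - 1) * p ≤ 1 / (2 * p) * p := by gcongr; linarith
      _ = 1 / 2 := by field_simp
  refine ⟨m, hm_ge, by linarith, ?_⟩
  have hm1 : 1 ≤ m := Nat.ceil_pos.2 (by positivity)
  calc 1 / 2 ≤ 1 + ((m - 1 : ℕ) : ℝ) * -p := by
        rw [Nat.cast_pred hm1]
        linarith
    _ ≤ (1 + -p) ^ (m - 1) := one_add_mul_le_pow (by linarith) _
    _ = (1 - p) ^ (m - 1) := by rw [← sub_eq_add_neg]

theorem one_add_log_le_three_mul_neg_log {x p : ℝ} (hx : 0 < x) (hxp : x * p ≤ 1)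
    (hp0 : 0 < p) (hp : p ≤ 1 / 2) : 1 + log x ≤ 3 * -log p := by
  have hlogx : log x ≤ -log p := by
    rw [← log_inv, ← one_div]
    exact log_le_log hx ((le_div_iff₀ hp0).2 hxp)
  have hlog2 : log 2 ≤ -log p := by
    rw [← log_inv, ← one_div]
    exact log_le_log two_pos ((le_div_iff₀ hp0).2 (by linarith))
  linarith [log_two_gt_d9]

theorem entropy_le_negMulLog_mul_log_card_unionClosure [Fintype α] {w : Finset α → ℝ}
    (hw : ∀ S, 0 ≤ w S) (hw1 : ∑ S, w S = 1) {F : Finset (Finset α)} (hF : ∀ S, w S ≠ 0 → S ∈ F)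
    {p : ℝ} (hp0 : 0 < p) (hp : p ≤ 1 / 2) (hs : ∀ a, ∑ S with a ∈ S, w S ≤ p) :
    entropy w id ≤ 60 * log #(unionClosure F) * negMulLog p := by
  obtain ⟨m, hm_ge, hm_le, hpow⟩ := exists_half_le_one_sub_pow hp0 hp
  have havoid : ∀ a, 1 / 2 ≤ (∑ S, {S | a ∉ S}.indicator w S) ^ (Fintype.card (Fin m) - 1) := by
    intro a
    rw [Fintype.card_fin]
    refine hpow.trans (pow_le_pow_left₀ (by linarith) ?_ _)
    have hsum := sum_filter_add_sum_filter_not univ (a ∈ ·) w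
    simp only [Set.indicator_apply, Set.mem_ofPred_eq, ← sum_filter]
    linarith [hs a]
  have hunion : entropy (piWeight (Fin m) w) (univ.biUnion ·) ≤ log #(unionClosure F) :=
    entropy_le_log_card (piWeight_nonneg hw) (by rw [sum_piWeight, hw1, one_pow]) fun ω hω =>
      biUnion_mem_unionClosure _ fun j hj => hF _ (prod_ne_zero_iff.1 hω j hj)
  have hm0 : (0 : ℝ) < m := by
    by_contra! h
    nlinarith
  have hlogp : 0 ≤ -log p := neg_nonneg.2 (log_nonpos hp0.le (by linarith))
  refine le_of_mul_le_mul_left ?_ (show 0 < m * (1 / 2 : ℝ) by positivity)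
  calc m * (1 / 2) * entropy w id
      ≤ 5 * (1 + log m) * entropy (piWeight (Fin m) w) (univ.biUnion ·) := by
        simpa only [Fintype.card_fin] using mul_entropy_le_entropy_biUnion hw hw1 havoid
    _ ≤ 5 * (1 + log m) * log #(unionClosure F) := by gcongr
    _ ≤ 5 * (3 * -log p) * log #(unionClosure F) := by
        gcongr
        exact one_add_log_le_three_mul_neg_log hm0 hm_le hp0 hp
    _ ≤ 5 * (3 * -log p) * log #(unionClosure F) * (2 * (m * p)) :=
        le_mul_of_one_le_right (by positivity) hm_ge
    _ = m * (1 / 2) * (60 * log #(unionClosure F) * negMulLog p) := by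
        rw [negMulLog]
        ring

end Unions

section Moonflower

variable {n k : ℕ} {F : Finset (Finset (Fin n))}

theorem MoonflowerFree.pos (hF : MoonflowerFree k F) : 0 < k := by
  rw [pos_iff_ne_zero]
  rintro rfl
  exact hF ⟨finZeroElim, finZeroElim, ∅, finZeroElim, finZeroElim⟩

theorem MoonflowerFree.card_lt (hF : MoonflowerFree k F) {X : Finset (Fin n)}
    (hX : ∀ a ∈ X, ∃ S ∈ F, X ∩ S = {a}) : #X < k := by
  by_contra! hk
  obtain ⟨x⟩ : Nonempty (Fin k ↪ X) := Function.Embedding.nonempty_of_card_le (by simpa using hk)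
  choose S hSF hS using fun i => hX (x i) (x i).2
  have hpetal : ∀ i, S i \ Xᶜ = {(x i : Fin n)} := fun i => by
    rw [sdiff_compl, inf_eq_inter, inter_comm, hS i]
  refine hF ⟨S, hSF, Xᶜ, fun i => hpetal i ▸ singleton_nonempty _, fun i j hij => ?_⟩
  rw [hpetal, hpetal, disjoint_singleton]
  exact fun h => hij (x.injective (Subtype.ext h))

theorem MoonflowerFree.vcDim_unionClosure_lt (hF : MoonflowerFree k F) :
    (unionClosure F).vcDim < k :=
  (Finset.sup_lt_iff hF.pos).2 fun _ hX => hF.card_lt fun _ =>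
    exists_mem_inter_eq_singleton_of_shatters_unionClosure (mem_shatterer.1 hX)

theorem sum_range_choose_le_pow (hk : 0 < k) (hkn : k ≤ n) :
    ∑ j ∈ range (k + 1), (n.choose j : ℝ) ≤ (exp 1 * n / k) ^ k := by
  have hn : 0 < n := hk.trans_le hkn
  set x : ℝ := k / n with hx
  have hx0 : 0 < x := by positivity
  have hx1 : x ≤ 1 := div_le_one_of_le₀ (by exact_mod_cast hkn) (by positivity)
  have hgen : (∑ j ∈ range (k + 1), (n.choose j : ℝ)) * x ^ k ≤ exp 1 ^ k := by
    calc (∑ j ∈ range (k + 1), (n.choose j : ℝ)) * x ^ k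
        ≤ ∑ j ∈ range (k + 1), x ^ j * (n.choose j : ℝ) := by
          rw [sum_mul]
          refine sum_le_sum fun j hj => ?_
          rw [mul_comm]
          exact mul_le_mul_of_nonneg_right
            (pow_le_pow_of_le_one hx0.le hx1 (mem_range_succ_iff.1 hj)) (Nat.cast_nonneg _)
      _ ≤ ∑ j ∈ range (n + 1), x ^ j * (n.choose j : ℝ) := by gcongr
      _ = (x + 1) ^ n := by simp only [add_pow, one_pow, mul_one]
      _ ≤ exp x ^ n := by gcongr; exact add_one_le_exp x
      _ = exp 1 ^ k := by
          rw [← exp_nat_mul, ← exp_nat_mul, hx]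
          congr 1
          field_simp
  calc _ ≤ exp 1 ^ k / x ^ k := (le_div_iff₀ (by positivity)).2 hgen
    _ = (exp 1 * n / k) ^ k := by rw [← div_pow, hx, div_div_eq_mul_div]

theorem MoonflowerFree.log_card_unionClosure_le (hF : MoonflowerFree k F) (hkn : k ≤ n) :
    log #(unionClosure F) ≤ k * log (exp 1 * n / k) := by
  have hsauer : #(unionClosure F) ≤ ∑ j ∈ range (k + 1), n.choose j := by
    calc #(unionClosure F) ≤ ∑ j ∈ Iic (unionClosure F).vcDim, n.choose j := by
          simpa only [Fintype.card_fin] using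
            (card_le_card_shatterer (unionClosure F)).trans card_shatterer_le_sum_vcDim
      _ ≤ ∑ j ∈ range (k + 1), n.choose j :=
          sum_le_sum_of_subset fun j hj => mem_range_succ_iff.2
            ((mem_Iic.1 hj).trans hF.vcDim_unionClosure_lt.le)
  rw [← log_pow]
  refine log_le_log (by exact_mod_cast (unionClosure_nonempty F).card_pos) ?_
  calc (#(unionClosure F) : ℝ) ≤ ∑ j ∈ range (k + 1), (n.choose j : ℝ) := by exact_mod_cast hsauer
    _ ≤ (exp 1 * n / k) ^ k := sum_range_choose_le_pow hF.pos hkn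

theorem entropy_toReal_id (D : PMF (Finset (Fin n))) :
    entropy (fun S => (D S).toReal) id = shannonEntropy D * log 2 := by
  have hlog2 : log 2 ≠ 0 := (log_pos one_lt_two).ne'
  rw [entropy, shannonEntropy, sum_mul]
  refine sum_congr rfl fun S _ => ?_
  simp only [law, id_eq, filter_eq', mem_univ, if_true, sum_singleton, negMulLog, logb, one_div,
    log_inv]
  field_simp

theorem negMulLog_eq_phi_mul_log_two (p : ℝ) : negMulLog p = phi p * log 2 := by
  have hlog2 : log 2 ≠ 0 := (log_pos one_lt_two).ne'
  rw [negMulLog, phi, logb, one_div, log_inv]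
  field_simp

theorem sum_pmf_toReal {α : Type*} [Fintype α] (D : PMF α) : ∑ a, (D a).toReal = 1 := by
  rw [← ENNReal.toReal_sum fun a _ => D.apply_ne_top a, ← tsum_fintype (L := .unconditional _),
    D.tsum_coe, ENNReal.toReal_one]

theorem shannonEntropy_le (hF : MoonflowerFree k F) (hkn : k ≤ n) {p : ℝ} (hp0 : 0 < p)
    (hp : p ≤ 1 / 2) {D : PMF (Finset (Fin n))} (hD : SupportedOn D F) (hs : IsSmooth p D) :
    shannonEntropy D ≤ 60 * (k * log (exp 1 * n / k)) * phi p := by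
  have hp1 : 0 ≤ negMulLog p := negMulLog_nonneg hp0.le (by linarith)
  refine le_of_mul_le_mul_right ?_ (log_pos one_lt_two)
  calc shannonEntropy D * log 2 = entropy (fun S => (D S).toReal) id := (entropy_toReal_id D).symm
    _ ≤ 60 * log #(unionClosure F) * negMulLog p :=
        entropy_le_negMulLog_mul_log_card_unionClosure (fun _ => ENNReal.toReal_nonneg)
          (sum_pmf_toReal D) (fun S hS => hD S fun h => hS (by rw [h, ENNReal.toReal_zero]))
          hp0 hp hs
    _ ≤ 60 * (k * log (exp 1 * n / k)) * negMulLog p := by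
        gcongr
        exact hF.log_card_unionClosure_le hkn
    _ = 60 * (k * log (exp 1 * n / k)) * phi p * log 2 := by
        rw [negMulLog_eq_phi_mul_log_two, mul_assoc _ (phi p)]

end Moonflower

theorem log_le_logb_two {x : ℝ} (hx : 1 ≤ x) : log x ≤ logb 2 x :=
  le_div_self (log_nonneg hx) (log_pos one_lt_two) (log_two_lt_d9.le.trans (by norm_num))

theorem log_exp_one_mul_le_two_mul_logb_two {x : ℝ} (hx : 2 ≤ x) :
    log (exp 1 * x) ≤ 2 * logb 2 x := by
  have hlogb : 1 ≤ logb 2 x := by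
    rwa [le_logb_iff_rpow_le one_lt_two (by linarith), rpow_one]
  rw [log_mul (exp_ne_zero 1) (by positivity), log_exp]
  linarith [log_le_logb_two (one_le_two.trans hx)]

theorem theorem3p3 :
    ∃ B : ℝ, 1 ≤ B ∧
      ∀ (n k : ℕ) (F : Finset (Finset (Fin n))), MoonflowerFree k F →
        ∀ p : ℝ, 0 < p → p ≤ 1 / 2 →
          ∀ D : PMF (Finset (Fin n)), SupportedOn D F → IsSmooth p D →
            (2 * k ≤ n →
              shannonEntropy D ≤ B * (k * Real.logb 2 ((n : ℝ) / k)) * phi p) ∧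
            (k ≤ n →
              shannonEntropy D ≤ B * (k * Real.logb 2 (Real.exp 1 * n / k)) * phi p) := by
  refine ⟨120, by norm_num, fun n k F hF p hp0 hp D hD hs => ?_⟩
  have hk : (0 : ℝ) < k := by exact_mod_cast hF.pos
  have hphi : 0 ≤ phi p :=
    mul_nonneg hp0.le (logb_nonneg one_lt_two ((one_le_div hp0).2 (by linarith)))
  refine ⟨fun hkn => ?_, fun hkn => ?_⟩
  · have hnk : (2 : ℝ) ≤ n / k := (le_div_iff₀ hk).2 (by exact_mod_cast hkn)
    calc shannonEntropy D ≤ 60 * (k * log (exp 1 * n / k)) * phi p :=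
          shannonEntropy_le hF (by lia) hp0 hp hD hs
      _ ≤ 60 * (k * (2 * logb 2 (n / k))) * phi p := by
          rw [mul_div_assoc]
          gcongr
          exact log_exp_one_mul_le_two_mul_logb_two hnk
      _ = 120 * (k * logb 2 (n / k)) * phi p := by ring
  · have henk : 1 ≤ exp 1 * n / k := by
      rw [one_le_div hk]
      nlinarith [add_one_le_exp (1 : ℝ), (Nat.cast_le (α := ℝ)).2 hkn]
    calc shannonEntropy D ≤ 60 * (k * log (exp 1 * n / k)) * phi p :=
          shannonEntropy_le hF hkn hp0 hp hD hs
      _ ≤ 120 * (k * logb 2 (exp 1 * n / k)) * phi p := by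
          gcongr
          · exact mul_nonneg hk.le (log_nonneg henk)
          · norm_num
          · exact log_le_logb_two henk
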